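/- Let $k$ be an algebraically closed field and let $n, r \ge 2$ be integers. Regard $\mathfrak{gl}_n(k)^r$ as affine space of dimension $rn^2$ with its Zariski topology; closures, irreducibility and dimension below refer to this topology. Let $\mathcal{N}_n \subset \mathfrak{gl}_n(k)$ be the set of nilpotent matrices, and for $V \subseteq \mathfrak{gl}_n(k)$ let $$C_r(V) = \{(v_1,\dots,v_r) \in V^r : v_iv_j = v_jv_i \text{ for all } i,j\}.$$ Call a nilpotent matrix regular if it is conjugate to the single nilpotent $n\times n$ Jordan block, and call a matrix nonderogatory if its minimal polynomial equals its characteristic polynomial. Let $N_n^r$ be the closure of the set of tuples in $C_r(\mathcal{N}_n)$ whose first matrix is regular nilpotent, and let $G_n^r$ be the closure of the set of tuples in $C_r(\mathfrak{gl}_n)$ whose first matrix is nonderogatory. Then: 1. $C_r(\mathcal{N}_n)$ is irreducible if and only if $C_r(\mathcal{N}_n) = N_n^r$; 2. $C_r(\mathfrak{gl}_n)$ is irreducible if and only if $C_r(\mathfrak{gl}_n) = G_n^r$; 3. $N_n^r$ and $G_n^r$ are irreducible, with $\dim N_n^r = n^2 - n + (r-1)(n-1)$ and $\dim G_n^r =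 n^2 + (r-1)n$. -/

import Mathlib

namespace CommutingVariety

/-- The affine space of `r`-tuples of `n × n` matrices over `k`. It is a type synonym, so that
its only topology is the Zariski topology defined below. -/
def MatTuple (k : Type*) (n r : ℕ) : Type _ := Fin r → Matrix (Fin n) (Fin n) k

variable {k : Type*} [Field k] {n r : ℕ}

/-- The value at the tuple `x` of a polynomial in the `r * n ^ 2` matrix entries. -/
noncomputable def evalAt (x : MatTuple k n r)
    (p : MvPolynomial (Fin r × Fin n × Fin n) k) : k :=
  MvPolynomial.eval (fun t => x t.1 t.2.1 t.2.2) p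

/-- The common zeros of a set of polynomials in the matrix entries. -/
def zeros (S : Set (MvPolynomial (Fin r × Fin n × Fin n) k)) : Set (MatTuple k n r) :=
  {x | ∀ p ∈ S, evalAt x p = 0}

/-- The Zariski topology: the closed sets are the common zero sets of sets of polynomials. -/
instance zariskiTopology : TopologicalSpace (MatTuple k n r) :=
  TopologicalSpace.ofClosed {Z | ∃ S, Z = zeros S}
    ⟨{1}, by ext x; simp [zeros, evalAt]⟩
    (by
      intro A hA
      refine ⟨{p | ∃ S, zeros S ∈ A ∧ p ∈ S}, ?_⟩
      ext x
      constructor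
      · rintro hx p ⟨S, hS, hp⟩
        exact hx _ hS p hp
      · intro hx Z hZ
        obtain ⟨S, rfl⟩ := hA hZ
        exact fun p hp => hx p ⟨S, hZ, hp⟩)
    (by
      rintro _ ⟨S, rfl⟩ _ ⟨T, rfl⟩
      refine ⟨{p | ∃ a ∈ S, ∃ b ∈ T, p = a * b}, ?_⟩
      ext x
      constructor
      · rintro (hx | hx) _ ⟨a, ha, b, hb, rfl⟩
        · simp [evalAt, show MvPolynomial.eval _ a = 0 from hx a ha]
        · simp [evalAt, show MvPolynomial.eval _ b = 0 from hx b hb]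
      · intro hx
        by_contra hcon
        simp only [Set.mem_union, not_or, zeros, Set.mem_ofPred_eq, not_forall] at hcon
        obtain ⟨⟨a, ha, ha'⟩, b, hb, hb'⟩ := hcon
        have h := hx _ ⟨a, ha, b, hb, rfl⟩
        simp only [evalAt, map_mul, mul_eq_zero] at h
        exact h.elim ha' hb')

theorem isClosed_iff (Z : Set (MatTuple k n r)) : IsClosed Z ↔ ∃ S, Z = zeros S := by
  rw [← isOpen_compl_iff]
  change Zᶜᶜ ∈ {Z : Set (MatTuple k n r) | ∃ S, Z = zeros S} ↔ _
  rw [compl_compl, Set.mem_ofPred_eq]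

/-- The commuting variety `C_r(V)` of pairwise commuting `r`-tuples of elements of `V`. -/
def commVariety (r : ℕ) (V : Set (Matrix (Fin n) (Fin n) k)) : Set (MatTuple k n r) :=
  {x | (∀ i, x i ∈ V) ∧ ∀ i j, x i * x j = x j * x i}

variable (k n)

/-- The nilpotent cone `𝒩_n`. -/
def nilCone : Set (Matrix (Fin n) (Fin n) k) := {A | IsNilpotent A}

/-- The principal nilpotent Jordan block: ones on the superdiagonal, zeros elsewhere. -/
def jordanBlock : Matrix (Fin n) (Fin n) k :=
  Matrix.of fun i j => if (j : ℕ) = (i : ℕ) + 1 then 1 else 0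

variable {k n}

/-- A regular nilpotent matrix: one that is conjugate to the principal Jordan block. -/
def IsRegularNilpotent (A : Matrix (Fin n) (Fin n) k) : Prop :=
  ∃ g : GL (Fin n) k, A = g.val * jordanBlock k n * g⁻¹.val

/-- A nonderogatory matrix: the minimal polynomial equals the characteristic polynomial. -/
def IsNonderogatory (A : Matrix (Fin n) (Fin n) k) : Prop :=
  minpoly k A = A.charpoly

variable (k n)

/-- `N_n^r`: the Zariski closure of the set of tuples in `C_r(𝒩_n)` whose first matrix is
regular nilpotent. -/
def regularClosure (r : ℕ) : Set (MatTuple k n r) :=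
  closure {x | x ∈ commVariety r (nilCone k n) ∧ ∃ h : 0 < r, IsRegularNilpotent (x ⟨0, h⟩)}

/-- `G_n^r`: the Zariski closure of the set of tuples in `C_r(𝔤𝔩_n)` whose first matrix is
nonderogatory. -/
def nonderogatoryClosure (r : ℕ) : Set (MatTuple k n r) :=
  closure {x | x ∈ commVariety r (Set.univ : Set (Matrix (Fin n) (Fin n) k)) ∧
    ∃ h : 0 < r, IsNonderogatory (x ⟨0, h⟩)}

end CommutingVariety

/-! A row vector `u` is cyclic for `A` if `u, uA, …, uA^(n-1)` form a basis. Having a cyclic vector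
is an open condition on `A`; over an algebraically closed field it means nonderogatory
(`isNonderogatory_iff`), and for nilpotent matrices it means regular (`isRegularNilpotent_iff`). So
`N_n^r` and `G_n^r` are closures of nonempty relatively open subsets of closed commuting varieties.
Such subsets are dense in an irreducible variety, so both equivalences follow once the two closures
are known to be irreducible (`isIrreducible_iff_eq_closure`).

A matrix commuting with a cyclic `A` is a polynomial in `A` of degree below `n`
(`exists_eq_sum_pow_of_commute`), so a tuple amounts to `A` and `r - 1` coefficient vectors, with
zero constant terms in the nilpotent case. For `G_n^r` the matrix `A` is generic; for `N_n^r` it is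
`adj(g) J g`, polynomial in `g`. Both loci are thus dominated by affine spaces, and their vanishing
ideals are kernels of maps to polynomial rings, hence prime (`vanishingIdeal_eq_ker`).

The Nullstellensatz and Noether normalization turn dimension into the transcendence degree of the
image ring, which is the number of parameters if these are algebraic over the image
(`trdeg_range_pullback`). Coefficients are recovered from the tuple by linear algebra. In the
nilpotent case the first row of `g` is normalized to `(1, 0, …, 0)`, leaving `n^2 - n` entries, and
`A` then determines `g` up to the extraction of one root, that giving `det g`. -/

namespace CommutingVariety

section ZariskiDimension

open MvPolynomial TopologicalSpace

/-! ### Krull dimension of finitely generated domains. -/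

section Dimension

/-- Incomparability makes contraction of primes strictly monotone; lying over and going up lift
every chain. -/
theorem ringKrullDim_eq_of_isIntegral {R S : Type*} [CommRing R] [CommRing S] [Algebra R S]
    [Algebra.IsIntegral R S] [FaithfulSMul R S] : ringKrullDim S = ringKrullDim R := by
  apply le_antisymm
  · refine Order.krullDim_le_of_strictMono (PrimeSpectrum.comap (algebraMap R S)) ?_
    intro P Q hPQ
    exact Ideal.IsIntegral.comap_lt_comap (R := R) (show P.asIdeal < Q.asIdeal from hPQ)
  · refine iSup_le fun l => ?_
    obtain ⟨P, hP, hlo⟩ := (inferInstance : Nonempty (Ideal.primesOver l.head.asIdeal S))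
    have := Algebra.HasGoingUp.of_isIntegral (R := R) (S := S)
    obtain ⟨L, hL, -⟩ := Ideal.exists_ltSeries_of_hasGoingUp l P
    rw [← hL]
    exact Order.LTSeries.length_le_krullDim L

theorem ringKrullDim_eq_of_trdeg {k R : Type*} [Field k] [CommRing R] [IsDomain R] [Algebra k R]
    [Algebra.FiniteType k R] {d : ℕ} (h : Algebra.trdeg k R = d) : ringKrullDim R = d := by
  obtain ⟨s, g, hg, hint⟩ := exists_integral_inj_algHom_of_fg k R
  algebraize [g.toRingHom]
  have : IsScalarTower k (MvPolynomial (Fin s) k) R := .of_algebraMap_eq fun x => (g.commutes x).symm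
  have : FaithfulSMul (MvPolynomial (Fin s) k) R :=
    (faithfulSMul_iff_algebraMap_injective _ _).2 hg
  have h1 := ringKrullDim_eq_of_isIntegral (R := MvPolynomial (Fin s) k) (S := R)
  -- Additivity of transcendence degree in the tower shows that Noether normalization uses exactly
  -- `d` variables.
  have h2 := _root_.lift_trdeg_add_eq k (MvPolynomial (Fin s) k) R
  rw [_root_.trdeg_eq_zero (R := MvPolynomial (Fin s) k) (A := R), h] at h2
  simp at h2
  rw [h1, MvPolynomial.ringKrullDim_of_isNoetherianRing, ringKrullDim_eq_zero_of_field]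
  simp [h2]

end Dimension

theorem isIrreducible_of_image {X Y : Type*} [TopologicalSpace X] [TopologicalSpace Y]
    {f : X → Y} (hf : Topology.IsInducing f) {s : Set X} (h : IsIrreducible (f '' s)) :
    IsIrreducible s := by
  refine ⟨h.nonempty.of_image, ?_⟩
  intro u v hu hv ⟨x, hxs, hxu⟩ ⟨y, hys, hyv⟩
  obtain ⟨u, hu', rfl⟩ := hf.isOpen_iff.1 hu
  obtain ⟨v, hv', rfl⟩ := hf.isOpen_iff.1 hv
  obtain ⟨_, ⟨z, hz, rfl⟩, hzuv⟩ := h.2 u v hu' hv' ⟨_, ⟨x, hxs, rfl⟩, hxu⟩ ⟨_, ⟨y, hys, rfl⟩, hyv⟩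
  exact ⟨z, hz, hzuv⟩

/-! ### The dictionary between Zariski closed sets and ideals. -/

variable {k : Type*} [Field k] {n r : ℕ}

/-- The ideal of polynomials in the matrix entries that vanish on `S`. -/
def vanishingIdeal (S : Set (MatTuple k n r)) :
    Ideal (MvPolynomial (Fin r × Fin n × Fin n) k) where
  carrier := {p | ∀ x ∈ S, evalAt x p = 0}
  zero_mem' _ _ := map_zero _
  add_mem' {p q} hp hq x hx := by
    simp only [evalAt, map_add]
    rw [← evalAt, ← evalAt, hp x hx, hq x hx, add_zero]
  smul_mem' p q hq x hx := by
    simp only [evalAt, smul_eq_mul, map_mul]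
    rw [← evalAt, ← evalAt, hq x hx, mul_zero]

theorem mem_vanishingIdeal {S : Set (MatTuple k n r)}
    {p : MvPolynomial (Fin r × Fin n × Fin n) k} :
    p ∈ vanishingIdeal S ↔ ∀ x ∈ S, evalAt x p = 0 := Iff.rfl

theorem vanishingIdeal_anti {S T : Set (MatTuple k n r)} (h : S ⊆ T) :
    vanishingIdeal T ≤ vanishingIdeal S := fun _ hp x hx => hp x (h hx)

theorem isClosed_zeros (S : Set (MvPolynomial (Fin r × Fin n × Fin n) k)) :
    IsClosed (zeros S) := (isClosed_iff _).2 ⟨S, rfl⟩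

theorem closure_eq_zeros (S : Set (MatTuple k n r)) :
    closure S = zeros (vanishingIdeal S : Set (MvPolynomial (Fin r × Fin n × Fin n) k)) := by
  apply subset_antisymm
  · exact closure_minimal (fun x hx p hp => hp x hx) (isClosed_zeros _)
  · obtain ⟨T, hT⟩ := (isClosed_iff _).1 (isClosed_closure (s := S))
    rw [hT]
    intro x hx p hp
    refine hx p fun y hy => ?_
    have : y ∈ zeros T := hT ▸ subset_closure hy
    exact this p hp

theorem vanishingIdeal_closure (S : Set (MatTuple k n r)) :
    vanishingIdeal (closure S) = vanishingIdeal S := by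
  apply le_antisymm (vanishingIdeal_anti subset_closure)
  intro p hp x hx
  rw [closure_eq_zeros] at hx
  exact hx p hp

theorem closure_subset_closure_of_vanishingIdeal_le {S T : Set (MatTuple k n r)}
    (h : vanishingIdeal T ≤ vanishingIdeal S) : closure S ⊆ closure T := by
  rw [closure_eq_zeros, closure_eq_zeros]
  exact fun x hx p hp => hx p (h hp)

theorem isIrreducible_iff (S : Set (MatTuple k n r)) :
    IsIrreducible S ↔ (vanishingIdeal S).IsPrime := by
  constructor
  · rintro ⟨hne, hpre⟩
    refine ⟨?_, ?_⟩
    · rw [Ideal.ne_top_iff_one]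
      intro h1
      obtain ⟨x, hx⟩ := hne
      simpa [evalAt] using h1 x hx
    · intro p q hpq
      by_contra! hcon
      obtain ⟨hp, hq⟩ := hcon
      simp only [mem_vanishingIdeal, not_forall] at hp hq
      obtain ⟨x, hx, hxp⟩ := hp
      obtain ⟨y, hy, hyq⟩ := hq
      obtain ⟨z, hz, hz1, hz2⟩ := hpre _ _ (isClosed_zeros {p}).isOpen_compl
        (isClosed_zeros {q}).isOpen_compl ⟨x, hx, by simpa [zeros] using hxp⟩
        ⟨y, hy, by simpa [zeros] using hyq⟩
      have := hpq z hz
      simp only [evalAt, map_mul, mul_eq_zero] at this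
      simp only [zeros, evalAt, Set.mem_singleton_iff, forall_eq, Set.mem_compl_iff,
        Set.mem_ofPred_eq] at hz1 hz2
      exact this.elim hz1 hz2
  · intro h
    refine ⟨?_, ?_⟩
    · by_contra hne
      rw [Set.not_nonempty_iff_eq_empty] at hne
      exact h.ne_top (by rw [Ideal.eq_top_iff_one]; simp [mem_vanishingIdeal, hne])
    · rw [isPreirreducible_iff_isClosed_union_isClosed]
      intro Z W hZ hW hSZW
      by_contra! hcon
      obtain ⟨A, rfl⟩ := (isClosed_iff _).1 hZ
      obtain ⟨B, rfl⟩ := (isClosed_iff _).1 hW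
      simp only [Set.not_subset] at hcon
      obtain ⟨⟨x, hx, hxA⟩, y, hy, hyB⟩ := hcon
      simp only [zeros, Set.mem_ofPred_eq, not_forall] at hxA hyB
      obtain ⟨p, hp, hxp⟩ := hxA
      obtain ⟨q, hq, hyq⟩ := hyB
      have : p * q ∈ vanishingIdeal S := by
        intro z hz
        simp only [evalAt, map_mul, mul_eq_zero]
        exact (hSZW hz).imp (fun h => h p hp) fun h => h q hq
      exact (h.mem_or_mem this).elim (fun h => hxp (h x hx)) fun h => hyq (h y hy)

theorem vanishingIdeal_zeros [IsAlgClosed k]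
    (P : Ideal (MvPolynomial (Fin r × Fin n × Fin n) k)) [hP : P.IsPrime] :
    vanishingIdeal (zeros (P : Set (MvPolynomial (Fin r × Fin n × Fin n) k))) = P := by
  conv_rhs => rw [← MvPolynomial.IsPrime.vanishingIdeal_zeroLocus (K := k) P]
  ext p
  simp only [mem_vanishingIdeal, MvPolynomial.mem_vanishingIdeal_iff, mem_zeroLocus_iff]
  constructor
  · intro h x hx
    exact h (fun i a b => x (i, a, b)) hx
  · intro h x hx
    exact h (fun t => x t.1 t.2.1 t.2.2) hx

/-- Irreducible closed subsets of the closure correspond, with order reversed, to primes over the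
vanishing ideal. Strict monotonicity of the two maps suffices; the Nullstellensatz gives it for
primes. -/
theorem topologicalKrullDim_closure [IsAlgClosed k] (S : Set (MatTuple k n r)) :
    topologicalKrullDim (closure S) =
      ringKrullDim (MvPolynomial (Fin r × Fin n × Fin n) k ⧸ vanishingIdeal S) := by
  rw [ringKrullDim_quotient, topologicalKrullDim, ← Order.krullDim_orderDual]
  have himg (W : IrreducibleCloseds (closure S)) :
      IsIrreducible (((↑) : closure S → MatTuple k n r) '' W) :=
    W.isIrreducible.image _ continuous_subtype_val.continuousOn
  have hcl (W : IrreducibleCloseds (closure S)) :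
      IsClosed (((↑) : closure S → MatTuple k n r) '' W) :=
    isClosed_closure.isClosedEmbedding_subtypeVal.isClosedMap _ W.isClosed
  apply le_antisymm
  · refine Order.krullDim_le_of_strictMono (fun W => ⟨⟨vanishingIdeal
      (((↑) : closure S → MatTuple k n r) '' (OrderDual.ofDual W : IrreducibleCloseds (closure S))),
      (isIrreducible_iff _).1 (himg _)⟩, ?_⟩) ?_
    · rw [PrimeSpectrum.mem_zeroLocus]
      change vanishingIdeal S ≤ _
      rw [← vanishingIdeal_closure]
      exact vanishingIdeal_anti (by rintro _ ⟨y, -, rfl⟩; exact y.2)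
    · intro W V hWV
      have hlt : OrderDual.ofDual V < OrderDual.ofDual W := hWV
      refine lt_of_le_not_ge (vanishingIdeal_anti (Set.image_mono hlt.le)) fun hge => ?_
      refine hlt.not_ge fun x hx => ?_
      have := closure_subset_closure_of_vanishingIdeal_le hge
      rw [(hcl _).closure_eq, (hcl _).closure_eq] at this
      obtain ⟨y, hy, hyx⟩ := this ⟨x, hx, rfl⟩
      exact Subtype.ext hyx ▸ hy
  · have hsub (P : PrimeSpectrum (MvPolynomial (Fin r × Fin n × Fin n) k))
        (hP : P ∈ PrimeSpectrum.zeroLocus (vanishingIdeal S : Set _)) :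
        zeros (P.asIdeal : Set (MvPolynomial (Fin r × Fin n × Fin n) k)) ⊆ closure S := by
      rw [closure_eq_zeros]
      exact fun x hx p hp => hx p (hP hp)
    have himg' (P : PrimeSpectrum (MvPolynomial (Fin r × Fin n × Fin n) k))
        (hP : P ∈ PrimeSpectrum.zeroLocus (vanishingIdeal S : Set _)) :
        ((↑) : closure S → MatTuple k n r) '' (((↑) : closure S → MatTuple k n r) ⁻¹'
          zeros (P.asIdeal : Set (MvPolynomial (Fin r × Fin n × Fin n) k))) =
        zeros (P.asIdeal : Set (MvPolynomial (Fin r × Fin n × Fin n) k)) := by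
      rw [Subtype.image_preimage_coe, Set.inter_eq_right]
      exact hsub P hP
    refine Order.krullDim_le_of_strictMono (fun P => OrderDual.toDual
      ⟨((↑) : closure S → MatTuple k n r) ⁻¹' zeros (P.1.asIdeal : Set _), ?_,
        (isClosed_zeros _).preimage continuous_subtype_val⟩) ?_
    · refine isIrreducible_of_image Topology.IsInducing.subtypeVal ?_
      rw [himg' P.1 P.2, isIrreducible_iff, vanishingIdeal_zeros]
      exact P.1.2
    · intro P Q hPQ
      have hlt : P.1.asIdeal < Q.1.asIdeal := hPQ
      refine lt_of_le_not_ge (fun x hx p hp => hx p (hlt.le hp)) fun hge => ?_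
      refine hlt.not_ge ?_
      rw [← vanishingIdeal_zeros P.1.asIdeal, ← vanishingIdeal_zeros Q.1.asIdeal,
        ← himg' P.1 P.2, ← himg' Q.1 Q.2]
      exact vanishingIdeal_anti (Set.image_mono hge)

/-! ### Families parametrized by affine space. -/

variable {σ : Type*}

/-- The point of `MatTuple k n r` with parameters `y`, for a tuple of matrices over a polynomial
ring in the parameters. -/
noncomputable def param (F : Fin r → Matrix (Fin n) (Fin n) (MvPolynomial σ k)) (y : σ → k) :
    MatTuple k n r := fun i => (F i).map (eval y)

/-- The comorphism of `param F`. -/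
noncomputable def pullback (F : Fin r → Matrix (Fin n) (Fin n) (MvPolynomial σ k)) :
    MvPolynomial (Fin r × Fin n × Fin n) k →ₐ[k] MvPolynomial σ k :=
  aeval fun t => F t.1 t.2.1 t.2.2

theorem eval_pullback (F : Fin r → Matrix (Fin n) (Fin n) (MvPolynomial σ k)) (y : σ → k)
    (p : MvPolynomial (Fin r × Fin n × Fin n) k) :
    eval y (pullback F p) = evalAt (param F y) p := by
  induction p using MvPolynomial.induction_on with
  | C a => simp [pullback, evalAt]
  | add p q hp hq => simp only [evalAt, map_add] at *; rw [hp, hq]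
  | mul_X p t hp => simp only [evalAt, map_mul] at *; rw [hp]; simp [pullback, param]

/-- If `p` vanishes on `S`, then `h * pullback F p` vanishes at every parameter, so it is zero over
an infinite field, and `h` cancels. -/
theorem vanishingIdeal_eq_ker [Infinite k]
    (F : Fin r → Matrix (Fin n) (Fin n) (MvPolynomial σ k)) {h : MvPolynomial σ k} (hh : h ≠ 0)
    {S : Set (MatTuple k n r)} (hS : ∀ y, eval y h ≠ 0 → param F y ∈ S)
    (hS' : S ⊆ closure (Set.range (param F))) :
    vanishingIdeal S = RingHom.ker (pullback F) := by
  have hrange : RingHom.ker (pullback F) ≤ vanishingIdeal (Set.range (param F)) := by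
    rintro p hp _ ⟨y, rfl⟩
    rw [← eval_pullback, (RingHom.mem_ker).1 hp, map_zero]
  apply le_antisymm
  · intro p hp
    rw [RingHom.mem_ker]
    refine (mul_eq_zero.1 (MvPolynomial.funext fun y => ?_)).resolve_left hh
    rw [map_mul, map_zero, mul_eq_zero, or_iff_not_imp_left, eval_pullback]
    exact fun hy => hp _ (hS y hy)
  · rw [← vanishingIdeal_closure] at hrange
    exact hrange.trans (vanishingIdeal_anti hS')

theorem isIrreducible_closure_of_param [Infinite k]
    (F : Fin r → Matrix (Fin n) (Fin n) (MvPolynomial σ k)) {h : MvPolynomial σ k} (hh : h ≠ 0)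
    {S : Set (MatTuple k n r)} (hS : ∀ y, eval y h ≠ 0 → param F y ∈ S)
    (hS' : S ⊆ closure (Set.range (param F))) : IsIrreducible (closure S) := by
  rw [isIrreducible_iff, vanishingIdeal_closure, vanishingIdeal_eq_ker F hh hS hS']
  exact RingHom.ker_isPrime _

/-- The hypothesis says that the parameters can be computed from the matrix entries by field
operations and root extraction, which makes them algebraic over the image. -/
theorem trdeg_range_pullback [Fintype σ]
    (F : Fin r → Matrix (Fin n) (Fin n) (MvPolynomial σ k))
    (hF : ∀ L : Subfield (FractionRing (MvPolynomial σ k)),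
      (∀ x, ∀ d : ℕ, d ≠ 0 → x ^ d ∈ L → x ∈ L) →
      (∀ i a b, algebraMap _ _ (F i a b) ∈ L) →
      ∀ s, algebraMap (MvPolynomial σ k) (FractionRing (MvPolynomial σ k)) (X s) ∈ L) :
    Algebra.trdeg k (pullback F).range = Fintype.card σ := by
  set R := (pullback F).range
  -- The elements algebraic over the image form a subfield closed under roots, so `hF` applies to
  -- it.
  let L : Subfield (FractionRing (MvPolynomial σ k)) :=
    { Subalgebra.algebraicClosure R (FractionRing (MvPolynomial σ k)) with
      neg_mem' := fun hx => IsAlgebraic.neg (R := R) hx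
      inv_mem' := fun x hx => IsAlgebraic.inv (R := R) hx }
  have hL (x) : x ∈ L ↔ IsAlgebraic R x := Iff.rfl
  have hX := hF L (fun x d hd hx => IsAlgebraic.of_pow (Nat.pos_of_ne_zero hd) hx) fun i a b => by
    have : F i a b ∈ R := ⟨X (i, a, b), by simp [pullback]⟩
    exact isAlgebraic_algebraMap (R := R) (A := FractionRing (MvPolynomial σ k)) ⟨_, this⟩
  have halg : Algebra.IsAlgebraic R (MvPolynomial σ k) := by
    refine ⟨fun p => ?_⟩
    rw [← isAlgebraic_algebraMap_iff
      (IsFractionRing.injective (MvPolynomial σ k) (FractionRing (MvPolynomial σ k)))]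
    induction p using MvPolynomial.induction_on with
    | C a =>
      exact isAlgebraic_algebraMap (R := R) (A := FractionRing (MvPolynomial σ k))
        ⟨C a, C a, by simp [pullback]⟩
    | add p q hp hq => rw [map_add]; exact hp.add hq
    | mul_X p s hp => rw [map_mul]; exact hp.mul ((hL _).1 (hX s))
  have h := _root_.lift_trdeg_add_eq k R (MvPolynomial σ k)
  rw [_root_.trdeg_eq_zero (R := R) (A := MvPolynomial σ k),
    MvPolynomial.trdeg_of_isDomain] at h
  simpa using h

theorem topologicalKrullDim_closure_of_param [IsAlgClosed k] [Fintype σ]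
    (F : Fin r → Matrix (Fin n) (Fin n) (MvPolynomial σ k)) {h : MvPolynomial σ k} (hh : h ≠ 0)
    {S : Set (MatTuple k n r)} (hS : ∀ y, eval y h ≠ 0 → param F y ∈ S)
    (hS' : S ⊆ closure (Set.range (param F)))
    (hF : ∀ L : Subfield (FractionRing (MvPolynomial σ k)),
      (∀ x, ∀ d : ℕ, d ≠ 0 → x ^ d ∈ L → x ∈ L) →
      (∀ i a b, algebraMap _ _ (F i a b) ∈ L) →
      ∀ s, algebraMap (MvPolynomial σ k) (FractionRing (MvPolynomial σ k)) (X s) ∈ L) :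
    topologicalKrullDim (closure S) = Fintype.card σ := by
  rw [topologicalKrullDim_closure, vanishingIdeal_eq_ker F hh hS hS',
    ringKrullDim_eq_of_ringEquiv (Ideal.quotientKerEquivRange (pullback F)).toRingEquiv]
  have : Algebra.FiniteType k (pullback F).range :=
    .of_surjective (pullback F).rangeRestrict (pullback F).rangeRestrict_surjective
  exact ringKrullDim_eq_of_trdeg (k := k) (trdeg_range_pullback F hF)

end ZariskiDimension

open Matrix

/-! ### Cyclic vectors and centralizers. -/

section Krylov

variable {R : Type*} [CommRing R] {n : ℕ}

/-- The matrix whose rows are `u, uA, …, uA^(n-1)`. -/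
def krylov (u : Fin n → R) (A : Matrix (Fin n) (Fin n) R) : Matrix (Fin n) (Fin n) R :=
  of fun i => u ᵥ* A ^ (i : ℕ)

theorem krylov_map {S : Type*} [CommRing S] (f : R →+* S) (u : Fin n → R)
    (A : Matrix (Fin n) (Fin n) R) : (krylov u A).map f = krylov (f ∘ u) (A.map f) := by
  ext i j
  simp only [krylov, map_apply, of_apply]
  rw [RingHom.map_vecMul, ← RingHom.mapMatrix_apply, ← RingHom.mapMatrix_apply, map_pow]

theorem vecMul_krylov (c u : Fin n → R) (A : Matrix (Fin n) (Fin n) R) :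
    c ᵥ* krylov u A = u ᵥ* ∑ l, c l • A ^ (l : ℕ) := by
  rw [vecMul_sum]
  ext j
  simp only [vecMul, dotProduct, krylov, of_apply, Finset.sum_apply, Matrix.smul_apply, smul_eq_mul]
  refine Finset.sum_congr rfl fun l _ => ?_
  rw [Finset.mul_sum]
  exact Finset.sum_congr rfl fun i _ => by ring

theorem krylov_row (u : Fin n → R) (A : Matrix (Fin n) (Fin n) R) (i : Fin n) :
    krylov u A i = u ᵥ* A ^ (i : ℕ) := rfl

theorem mul_row (A B : Matrix (Fin n) (Fin n) R) (i : Fin n) : (A * B) i = A i ᵥ* B := by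
  ext j; rfl

theorem krylov_mul_of_commute (u : Fin n → R) {A B : Matrix (Fin n) (Fin n) R}
    (h : A * B = B * A) : krylov u A * B = krylov (u ᵥ* B) A := by
  funext i
  rw [mul_row, krylov_row, krylov_row, vecMul_vecMul, vecMul_vecMul]
  rw [(show Commute A B from h).pow_left i]

/-- Choose the coefficients so that `B` and the polynomial in `A` agree on `u`. Both commute with
`A`, so they agree on every `u A^i`, and these span. -/
theorem exists_eq_sum_pow_of_commute {k : Type*} [Field k] {u : Fin n → k}
    {A B : Matrix (Fin n) (Fin n) k} (hu : (krylov u A).det ≠ 0) (h : A * B = B * A) :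
    ∃ c : Fin n → k, B = ∑ l, c l • A ^ (l : ℕ) := by
  have hK : IsUnit (krylov u A).det := hu.isUnit
  refine ⟨u ᵥ* B ᵥ* (krylov u A)⁻¹, ?_⟩
  set c := u ᵥ* B ᵥ* (krylov u A)⁻¹
  have h1 : u ᵥ* B = u ᵥ* ∑ l, c l • A ^ (l : ℕ) := by
    rw [← vecMul_krylov, vecMul_vecMul, nonsing_inv_mul _ hK, vecMul_one]
  have h2 : A * (∑ l, c l • A ^ (l : ℕ)) = (∑ l, c l • A ^ (l : ℕ)) * A := by
    simp only [Finset.mul_sum, Finset.sum_mul, Matrix.mul_smul, Matrix.smul_mul, ← pow_succ,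
      ← pow_succ']
  have h3 := krylov_mul_of_commute u h
  rw [h1, ← krylov_mul_of_commute u h2] at h3
  have h4 := congrArg ((krylov u A)⁻¹ * ·) h3
  simpa only [nonsing_inv_mul_cancel_left _ _ hK] using h4

theorem mul_pow_of_mul_eq {g A B : Matrix (Fin n) (Fin n) R} {d : R}
    (h : g * A = d • (B * g)) (l : ℕ) : g * A ^ l = d ^ l • (B ^ l * g) := by
  induction l with
  | zero => simp
  | succ l ih =>
    rw [pow_succ, ← mul_assoc, ih, Matrix.smul_mul, mul_assoc, h, Matrix.mul_smul, smul_smul, ← mul_assoc,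
      ← pow_succ, ← pow_succ]

end Krylov

/-! ### Regular nilpotent matrices and cyclic vectors. -/

section Jordan

variable {R : Type*} [CommRing R] {k : Type*} [Field k] {m n : ℕ}

/-- The principal Jordan block over a commutative ring. -/
def jordan (R : Type*) [CommRing R] (n : ℕ) : Matrix (Fin n) (Fin n) R :=
  of fun i j => if (j : ℕ) = (i : ℕ) + 1 then 1 else 0

theorem jordanBlock_eq : jordanBlock k n = jordan k n := rfl

theorem jordan_apply (i j : Fin n) :
    jordan R n i j = if (j : ℕ) = (i : ℕ) + 1 then 1 else 0 := rfl

theorem jordan_map {S : Type*} [CommRing S] (f : R →+* S) :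
    (jordan R n).map f = jordan S n := by
  ext i j
  simp only [jordan, map_apply, of_apply]
  split_ifs <;> simp

theorem jordan_pow_apply (l : ℕ) (i j : Fin n) :
    (jordan R n ^ l) i j = if (j : ℕ) = (i : ℕ) + l then 1 else 0 := by
  induction l generalizing j with
  | zero => simp [one_apply, Fin.ext_iff, eq_comm]
  | succ l ih =>
    rw [pow_succ, mul_apply]
    simp only [ih, jordan_apply, ite_mul, one_mul, zero_mul]
    by_cases hl : (i : ℕ) + l < n
    · rw [Finset.sum_eq_single (⟨(i : ℕ) + l, hl⟩ : Fin n)]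
      · simp [add_assoc]
      · intro b _ hb
        rw [if_neg fun h => hb (Fin.ext h)]
      · simp
    · rw [if_neg (by omega)]
      refine Finset.sum_eq_zero fun b _ => ?_
      rw [if_neg (by omega)]

theorem jordan_pow_card : jordan R n ^ n = 0 := by
  ext i j
  rw [jordan_pow_apply, if_neg (by omega)]
  rfl

theorem single_vecMul_jordan_pow (i : Fin (m + 1)) :
    (Pi.single 0 1 : Fin (m + 1) → R) ᵥ* jordan R (m + 1) ^ (i : ℕ) = Pi.single i 1 := by
  ext j
  rw [single_one_vecMul, row_apply, jordan_pow_apply]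
  simp [Pi.single_apply, Fin.ext_iff]

/-- `A` carries each row of `g` to `d` times the next, so the iterates of the first row are the rows
of `g` scaled by powers of `d`. -/
theorem krylov_of_mul_eq {g A : Matrix (Fin (m + 1)) (Fin (m + 1)) R} {d : R}
    (h : g * A = d • (jordan R (m + 1) * g)) :
    krylov (g 0) A = diagonal (fun i : Fin (m + 1) => d ^ (i : ℕ)) * g := by
  funext i
  have h0 : g 0 = Pi.single 0 1 ᵥ* g := by rw [single_one_vecMul]; rfl
  rw [krylov_row, h0, vecMul_vecMul, mul_pow_of_mul_eq h, vecMul_smul, ← vecMul_vecMul,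
    single_vecMul_jordan_pow, single_one_vecMul]
  ext j
  simp [diagonal_mul]

theorem det_krylov_of_mul_eq {g A : Matrix (Fin (m + 1)) (Fin (m + 1)) R} {d : R}
    (h : g * A = d • (jordan R (m + 1) * g)) :
    (krylov (g 0) A).det = d ^ (∑ i : Fin (m + 1), (i : ℕ)) * g.det := by
  rw [krylov_of_mul_eq h, det_mul, det_diagonal, Finset.prod_pow_eq_pow_sum]

theorem krylov_mul_self {u : Fin n → R} {A : Matrix (Fin n) (Fin n) R} (hA : A ^ n = 0) :
    krylov u A * A = jordan R n * krylov u A := by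
  funext i
  rw [mul_row, krylov_row, vecMul_vecMul, ← pow_succ]
  ext j
  rw [mul_apply]
  by_cases hi : (i : ℕ) + 1 < n
  · rw [Finset.sum_eq_single (⟨(i : ℕ) + 1, hi⟩ : Fin n)]
    · simp [jordan, krylov_row]
    · intro b _ hb
      rw [jordan, of_apply, if_neg fun h => hb (Fin.ext h), zero_mul]
    · simp
  · have : (i : ℕ) + 1 = n := by omega
    rw [this, hA, vecMul_zero, Finset.sum_eq_zero]
    · rfl
    · intro b _
      rw [jordan, of_apply, if_neg (by omega), zero_mul]

/-- A matrix with a cyclic row vector. -/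
def IsCyclic (A : Matrix (Fin n) (Fin n) k) : Prop := ∃ u, (krylov u A).det ≠ 0

theorem pow_card_eq_zero {A : Matrix (Fin n) (Fin n) k} (h : IsNilpotent A) : A ^ n = 0 := by
  have h1 : A.charpoly = Polynomial.X ^ n := by
    have := (Matrix.isNilpotent_charpoly_sub_pow_of_isNilpotent h).eq_zero
    simpa [sub_eq_zero] using this
  simpa [h1] using aeval_self_charpoly A

theorem isNilpotent_of_mul_eq {g A : Matrix (Fin n) (Fin n) k} {d : k} (hg : g.det ≠ 0)
    (h : g * A = d • (jordan k n * g)) : IsNilpotent A := by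
  refine ⟨n, ?_⟩
  have := mul_pow_of_mul_eq h n
  rw [jordan_pow_card, zero_mul, smul_zero] at this
  have h4 := congrArg (g⁻¹ * ·) this
  simpa only [nonsing_inv_mul_cancel_left _ _ hg.isUnit, mul_zero] using h4

theorem isCyclic_of_mul_eq {g A : Matrix (Fin (m + 1)) (Fin (m + 1)) k} {d : k}
    (hg : g.det ≠ 0) (hd : d ≠ 0) (h : g * A = d • (jordan k (m + 1) * g)) : IsCyclic A :=
  ⟨g 0, by rw [det_krylov_of_mul_eq h]; exact mul_ne_zero (pow_ne_zero _ hd) hg⟩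

theorem isRegularNilpotent_iff {A : Matrix (Fin (m + 1)) (Fin (m + 1)) k} :
    IsRegularNilpotent A ↔ IsNilpotent A ∧ IsCyclic A := by
  constructor
  · rintro ⟨g, rfl⟩
    have h : g⁻¹.val * (g.val * jordanBlock k (m + 1) * g⁻¹.val) =
        (1 : k) • (jordan k (m + 1) * g⁻¹.val) := by
      rw [one_smul, ← mul_assoc, ← mul_assoc, ← Units.val_mul, inv_mul_cancel, Units.val_one,
        one_mul, jordanBlock_eq]
    have hg : (g⁻¹.val).det ≠ 0 := ((isUnit_iff_isUnit_det _).1 g⁻¹.isUnit).ne_zero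
    exact ⟨isNilpotent_of_mul_eq hg h, isCyclic_of_mul_eq hg one_ne_zero h⟩
  · rintro ⟨hA, u, hu⟩
    have hK : IsUnit (krylov u A) := (isUnit_iff_isUnit_det _).2 hu.isUnit
    have h := krylov_mul_self (u := u) (pow_card_eq_zero hA)
    refine ⟨hK.unit⁻¹, ?_⟩
    rw [jordanBlock_eq, inv_inv, mul_assoc]
    change _ = hK.unit⁻¹.val * (jordan k (m + 1) * krylov u A)
    rw [← h]
    change A = hK.unit⁻¹.val * (hK.unit.val * A)
    rw [← mul_assoc, ← Units.val_mul, inv_mul_cancel, Units.val_one, one_mul]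

theorem isCyclic_jordan : IsCyclic (jordan k (m + 1)) :=
  isCyclic_of_mul_eq (g := 1) (d := 1) (by simp) one_ne_zero (by simp)

end Jordan

/-! ### Nonderogatory means cyclic. -/

section Nonderogatory

open Polynomial

variable {k : Type*} [Field k] {n : ℕ}

theorem sum_smul_pow_eq_aeval (c : Fin n → k) (A : Matrix (Fin n) (Fin n) k) :
    ∑ l, c l • A ^ (l : ℕ) = aeval A (∑ l, C (c l) * X ^ (l : ℕ)) := by
  simp [map_sum, Algebra.smul_def]

theorem isNonderogatory_of_isCyclic {A : Matrix (Fin n) (Fin n) k} (h : IsCyclic A) :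
    IsNonderogatory A := by
  obtain ⟨u, hu⟩ := h
  refine (Polynomial.eq_of_monic_of_dvd_of_natDegree_le (minpoly.monic (isIntegral A))
    (charpoly_monic A) (minpoly_dvd_charpoly A) ?_).symm
  rw [charpoly_natDegree_eq_dim, Fintype.card_fin]
  by_contra! hlt
  set c : Fin n → k := fun l => (minpoly k A).coeff l
  have hc : (∑ l : Fin n, C (c l) * X ^ (l : ℕ)) = minpoly k A := by
    conv_rhs => rw [as_sum_range' (minpoly k A) n hlt]
    rw [Finset.sum_range]
    simp [c, C_mul_X_pow_eq_monomial]
  have h0 : c ᵥ* krylov u A = 0 := by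
    rw [vecMul_krylov, sum_smul_pow_eq_aeval, hc, minpoly.aeval, vecMul_zero]
  have hc0 : c = 0 := by
    by_contra hne
    exact hu (exists_vecMul_eq_zero_iff.1 ⟨c, hne, h0⟩)
  refine minpoly.ne_zero (isIntegral A) ?_
  rw [← hc]
  simp [hc0]

/-- Without a cyclic vector, every `u` is killed by `(μ / (X - a))(A)` for some root `a` of the
minimal polynomial `μ`. These finitely many kernels cover the space; as the field is infinite one
kernel is everything, against minimality of `μ`. -/
theorem isCyclic_of_isNonderogatory [IsAlgClosed k] {A : Matrix (Fin n) (Fin n) k}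
    (h : IsNonderogatory A) : IsCyclic A := by
  classical
  set μ := minpoly k A
  have hμ0 : μ ≠ 0 := minpoly.ne_zero (isIntegral A)
  have hμn : μ.natDegree = n := by
    rw [show μ = A.charpoly from h, charpoly_natDegree_eq_dim, Fintype.card_fin]
  by_contra hcon
  simp only [IsCyclic, not_exists, not_not] at hcon
  let W : k → Submodule k (Fin n → k) := fun a =>
    LinearMap.ker (vecMulLinear (aeval A (μ /ₘ (X - C a))))
  have hcover : ⋃ p ∈ μ.roots.toFinset.image W, (p : Set (Fin n → k)) = Set.univ := by
    rw [Set.eq_univ_iff_forall]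
    intro u
    obtain ⟨c, hc, hcu⟩ := exists_vecMul_eq_zero_iff.2 (hcon u)
    rw [vecMul_krylov, sum_smul_pow_eq_aeval] at hcu
    set q := ∑ l : Fin n, C (c l) * X ^ (l : ℕ)
    have hq0 : q ≠ 0 := by
      intro hq
      apply hc
      ext l
      have := congrArg (fun p => p.coeff (l : ℕ)) hq
      simpa [q, finsetSum_coeff, coeff_C_mul, coeff_X_pow, Fin.val_inj] using this
    have hqn : q.natDegree < n := by
      rw [natDegree_lt_iff_degree_lt hq0]; exact degree_sum_fin_lt c
    -- By Bézout `d(A)` kills `u` too, and `deg d < n = deg μ` leaves a nonconstant cofactor `e`,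
    -- which has a root.
    set d := EuclideanDomain.gcd q μ
    have hd : u ᵥ* aeval A d = 0 := by
      rw [show d = _ from EuclideanDomain.gcd_eq_gcd_ab q μ, map_add, map_mul, map_mul, minpoly.aeval, zero_mul,
        add_zero, ← vecMul_vecMul, hcu, zero_vecMul]
    obtain ⟨e, he⟩ : d ∣ μ := EuclideanDomain.gcd_dvd_right q μ
    have hd0 : d ≠ 0 := fun h0 => hμ0 (by rw [he, h0, zero_mul])
    have he0 : e ≠ 0 := fun h0 => hμ0 (by rw [he, h0, mul_zero])
    have hdq : d.natDegree ≤ q.natDegree :=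
      natDegree_le_of_dvd (EuclideanDomain.gcd_dvd_left q μ) hq0
    have hed : e.degree ≠ 0 := by
      intro h0
      have h1 : e.natDegree = 0 := natDegree_eq_of_degree_eq_some h0
      have h2 := congrArg natDegree he
      rw [natDegree_mul hd0 he0] at h2
      omega
    obtain ⟨a, ha⟩ := IsAlgClosed.exists_root e hed
    have hra : IsRoot μ a := by rw [he]; exact root_mul_left_of_isRoot d ha
    obtain ⟨f, hf⟩ := dvd_iff_isRoot.2 ha
    have hdiv : μ /ₘ (X - C a) = d * f := by
      rw [he, hf, show d * ((X - C a) * f) = (X - C a) * (d * f) by ring,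
        mul_divByMonic_cancel_left _ (monic_X_sub_C a)]
    simp only [Set.mem_iUnion]
    refine ⟨W a, Finset.mem_image_of_mem _ (by simpa using ⟨hμ0, hra⟩), ?_⟩
    simp only [W, hdiv, SetLike.mem_coe, LinearMap.mem_ker, vecMulLinear_apply, map_mul]
    rw [← vecMul_vecMul, hd, zero_vecMul]
  have htop := Subspace.top_mem_of_biUnion_eq_univ hcover
  obtain ⟨a, ha, hWa⟩ := Finset.mem_image.1 htop
  have hra : IsRoot μ a := (mem_roots hμ0).1 (Multiset.mem_toFinset.1 ha)
  have hzero : aeval A (μ /ₘ (X - C a)) = 0 := by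
    ext1 i
    have : (Pi.single i 1 : Fin n → k) ∈ W a := hWa ▸ Submodule.mem_top
    rw [LinearMap.mem_ker, vecMulLinear_apply, single_one_vecMul] at this
    exact congrFun this
  have hmul := mul_divByMonic_eq_iff_isRoot.2 hra
  have hne : μ /ₘ (X - C a) ≠ 0 := fun h0 => hμ0 (by rw [← hmul, h0, mul_zero])
  have h1 := natDegree_le_natDegree (minpoly.degree_le_of_ne_zero k A hne hzero)
  have h2 := congrArg natDegree hmul
  rw [natDegree_mul (X_sub_C_ne_zero a) hne, natDegree_X_sub_C] at h2
  change μ.natDegree ≤ _ at h1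
  omega

theorem isNonderogatory_iff [IsAlgClosed k] {A : Matrix (Fin n) (Fin n) k} :
    IsNonderogatory A ↔ IsCyclic A :=
  ⟨isCyclic_of_isNonderogatory, isNonderogatory_of_isCyclic⟩

end Nonderogatory

open Matrix

/-! ### Tuples of polynomials in one matrix. -/

section Tuple

variable {R : Type*} [CommRing R] {m n s : ℕ}

/-- The tuple consisting of `A` and of polynomials in `A` with the given coefficients. -/
def polyTuple (A : Matrix (Fin n) (Fin n) R) (c : Fin s → Fin n → R) :
    Fin (s + 1) → Matrix (Fin n) (Fin n) R :=
  Fin.cons A fun i => ∑ l, c i l • A ^ (l : ℕ)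

theorem polyTuple_succ (A : Matrix (Fin n) (Fin n) R) (c : Fin s → Fin n → R) (i : Fin s) :
    polyTuple A c i.succ = ∑ l, c i l • A ^ (l : ℕ) := rfl

theorem sum_smul_pow_map {S : Type*} [CommRing S] (f : R →+* S) (A : Matrix (Fin n) (Fin n) R)
    (c : Fin n → R) :
    (∑ l, c l • A ^ (l : ℕ)).map f = ∑ l, f (c l) • (A.map f) ^ (l : ℕ) := by
  rw [← RingHom.mapMatrix_apply, map_sum]
  refine Finset.sum_congr rfl fun l _ => ?_
  rw [RingHom.mapMatrix_apply, Matrix.map_smul' f _ _ (map_mul f), ← RingHom.mapMatrix_apply, map_pow,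
    RingHom.mapMatrix_apply]

theorem polyTuple_map {S : Type*} [CommRing S] (f : R →+* S) (A : Matrix (Fin n) (Fin n) R)
    (c : Fin s → Fin n → R) (i : Fin (s + 1)) :
    (polyTuple A c i).map f = polyTuple (A.map f) (fun i l => f (c i l)) i := by
  refine Fin.cases rfl (fun i => ?_) i
  rw [polyTuple_succ, polyTuple_succ, sum_smul_pow_map]

theorem commute_polyTuple (A : Matrix (Fin n) (Fin n) R) (c : Fin s → Fin n → R)
    (i : Fin (s + 1)) : Commute A (polyTuple A c i) := by
  refine Fin.cases (Commute.refl A) (fun i => ?_) i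
  rw [polyTuple_succ]
  exact Commute.sum_right _ _ _ fun l _ => ((Commute.refl A).pow_right l).smul_right _

theorem commute_polyTuple_polyTuple (A : Matrix (Fin n) (Fin n) R) (c : Fin s → Fin n → R)
    (i j : Fin (s + 1)) : Commute (polyTuple A c i) (polyTuple A c j) := by
  refine Fin.cases (commute_polyTuple A c j) (fun i => ?_) i
  rw [polyTuple_succ]
  exact Commute.sum_left _ _ _ fun l _ => ((commute_polyTuple A c j).pow_left l).smul_left _

/-- The matrix `adj(g) J g`, equal to `det(g) g⁻¹ J g` when `g` is invertible. -/
def conjJordan (g : Matrix (Fin n) (Fin n) R) : Matrix (Fin n) (Fin n) R :=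
  g.adjugate * jordan R n * g

theorem conjJordan_map {S : Type*} [CommRing S] (f : R →+* S) (g : Matrix (Fin n) (Fin n) R) :
    (conjJordan g).map f = conjJordan (g.map f) := by
  rw [conjJordan, conjJordan, ← jordan_map f]
  simp only [← RingHom.mapMatrix_apply, map_mul, RingHom.map_adjugate]

theorem mul_conjJordan (g : Matrix (Fin n) (Fin n) R) :
    g * conjJordan g = g.det • (jordan R n * g) := by
  rw [conjJordan, ← mul_assoc, ← mul_assoc, mul_adjugate, Matrix.smul_mul, Matrix.smul_mul, one_mul]

/-- The terms of positive degree sum to a nilpotent matrix commuting with the scalar `c 0`. -/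
theorem isNilpotent_sum_smul_pow {k : Type*} [Field k] {A : Matrix (Fin (m + 1)) (Fin (m + 1)) k}
    (hA : IsNilpotent A) (c : Fin (m + 1) → k) :
    IsNilpotent (∑ l, c l • A ^ (l : ℕ)) ↔ c 0 = 0 := by
  have hcomm : Commute A (∑ l : Fin m, c l.succ • A ^ (l : ℕ)) :=
    Commute.sum_right _ _ _ fun l _ => ((Commute.refl A).pow_right l).smul_right _
  have hB : IsNilpotent (∑ l : Fin m, c l.succ • A ^ (l.succ : ℕ)) := by
    have := hcomm.isNilpotent_mul_right hA
    simpa only [Finset.mul_sum, Matrix.mul_smul, Fin.val_succ, pow_succ'] using this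
  rw [Fin.sum_univ_succ]
  constructor
  · intro h
    have hc : Commute (∑ l : Fin m, c l.succ • A ^ (l.succ : ℕ)) (c 0 • A ^ ((0 : Fin (m + 1)) : ℕ)
        + ∑ l : Fin m, c l.succ • A ^ (l.succ : ℕ)) := by
      refine Commute.add_right ?_ (Commute.refl _)
      simp only [Fin.val_zero, pow_zero]
      exact (Commute.one_right _).smul_right _
    have h1 := hc.symm.isNilpotent_sub h hB
    rw [add_sub_cancel_right, Fin.val_zero, pow_zero] at h1
    obtain ⟨N, hN⟩ := h1
    rw [smul_pow, one_pow, smul_eq_zero] at hN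
    exact eq_zero_of_pow_eq_zero (hN.resolve_right one_ne_zero)
  · intro h
    rwa [h, zero_smul, zero_add]

end Tuple

/-! ### Normal forms for commuting tuples with cyclic first entry. -/

section Sets

variable {k : Type*} [Field k] {m n s : ℕ}

theorem polyTuple_mem_commVariety (A : Matrix (Fin n) (Fin n) k) (c : Fin s → Fin n → k) :
    polyTuple A c ∈ commVariety (s + 1) (Set.univ : Set (Matrix (Fin n) (Fin n) k)) :=
  ⟨fun _ => trivial, fun i j => commute_polyTuple_polyTuple A c i j⟩

theorem polyTuple_mem_commVariety_nilCone {A : Matrix (Fin (m + 1)) (Fin (m + 1)) k}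
    (hA : IsNilpotent A) {c : Fin s → Fin (m + 1) → k} (hc : ∀ i, c i 0 = 0) :
    polyTuple A c ∈ commVariety (s + 1) (nilCone k (m + 1)) := by
  refine ⟨fun i => ?_, fun i j => commute_polyTuple_polyTuple A c i j⟩
  refine Fin.cases hA (fun i => ?_) i
  exact (isNilpotent_sum_smul_pow hA _).2 (hc i)

theorem exists_eq_polyTuple {V : Set (Matrix (Fin n) (Fin n) k)} {x : MatTuple k n (s + 1)}
    (hx : x ∈ commVariety (s + 1) V) (h : IsCyclic (x 0)) : ∃ c, x = polyTuple (x 0) c := by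
  obtain ⟨u, hu⟩ := h
  choose c hc using fun i : Fin s => exists_eq_sum_pow_of_commute hu (hx.2 0 i.succ)
  refine ⟨c, funext fun i => ?_⟩
  exact Fin.cases rfl (fun i => hc i) i

theorem exists_eq_polyTuple_of_nilCone {x : MatTuple k (m + 1) (s + 1)}
    (hx : x ∈ commVariety (s + 1) (nilCone k (m + 1))) (h : IsCyclic (x 0)) :
    ∃ c : Fin s → Fin m → k, x = polyTuple (x 0) (fun i => Fin.cons 0 (c i)) := by
  obtain ⟨c, hc⟩ := exists_eq_polyTuple hx h
  refine ⟨fun i => Fin.tail (c i), ?_⟩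
  have hi (i : Fin s) : c i 0 = 0 := by
    have h1 := hx.1 i.succ
    rw [hc] at h1
    exact (isNilpotent_sum_smul_pow (hx.1 0) _).1 h1
  have : (fun i => Fin.cons 0 (Fin.tail (c i))) = c := by
    funext i
    rw [← hi i, Fin.cons_self_tail]
  rw [this]
  exact hc

theorem conjJordan_eq {g A : Matrix (Fin n) (Fin n) k} (hg : g.det ≠ 0)
    (h : g * A = g.det • (jordan k n * g)) : conjJordan g = A := by
  rw [← mul_conjJordan] at h
  have h4 := congrArg (g⁻¹ * ·) h
  simpa only [nonsing_inv_mul_cancel_left _ _ hg.isUnit] using h4.symm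

theorem exists_conjJordan_eq [IsAlgClosed k] {A : Matrix (Fin (m + 1)) (Fin (m + 1)) k}
    (hA : IsNilpotent A) (h : IsCyclic A) : ∃ g, conjJordan g = A := by
  obtain ⟨u, hu⟩ := h
  -- Scaling to determinant 1 removes the factor `det g` by which `adj(g)` differs from the inverse
  -- of `g`.
  obtain ⟨z, hz⟩ := IsAlgClosed.exists_pow_nat_eq (krylov u A).det⁻¹ m.succ_pos
  have hdet : (z • krylov u A).det = 1 := by
    rw [det_smul, Fintype.card_fin, hz, inv_mul_cancel₀ hu]
  refine ⟨z • krylov u A, conjJordan_eq (by rw [hdet]; exact one_ne_zero) ?_⟩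
  rw [hdet, one_smul, Matrix.smul_mul, krylov_mul_self (pow_card_eq_zero hA), Matrix.mul_smul]

/-- Here the first row is prescribed, so scalar rescaling is unavailable. Scaling row `i` of the
Krylov matrix by `d⁻¹ ^ i` fixes the first row; the determinant becomes `d` exactly when `d ^ (1 + ∑
i)` is the Krylov determinant. -/
theorem exists_conjJordan_eq_of_krylov [IsAlgClosed k]
    {A : Matrix (Fin (m + 1)) (Fin (m + 1)) k} (hA : IsNilpotent A) {u : Fin (m + 1) → k}
    (hu : (krylov u A).det ≠ 0) : ∃ g, g 0 = u ∧ conjJordan g = A := by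
  obtain ⟨d, hd⟩ := IsAlgClosed.exists_pow_nat_eq (krylov u A).det
    (Nat.succ_pos (∑ i : Fin (m + 1), (i : ℕ)))
  have hd0 : d ≠ 0 := by
    rintro rfl
    exact hu (by rw [← hd, zero_pow (Nat.succ_ne_zero _)])
  set D : Matrix (Fin (m + 1)) (Fin (m + 1)) k := diagonal fun i => d⁻¹ ^ (i : ℕ)
  have hdet : (D * krylov u A).det = d := by
    rw [det_mul, det_diagonal, Finset.prod_pow_eq_pow_sum, ← hd, pow_succ, inv_pow,
      inv_mul_cancel_left₀ (pow_ne_zero _ hd0)]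
  have hDJ : D * jordan k (m + 1) = d • (jordan k (m + 1) * D) := by
    ext i j
    rw [diagonal_mul, Matrix.smul_apply, mul_diagonal, jordan_apply]
    split_ifs with hij
    · rw [hij, pow_succ, smul_eq_mul]
      field_simp
    · simp
  refine ⟨D * krylov u A, ?_, conjJordan_eq (by rw [hdet]; exact hd0) ?_⟩
  · ext j
    simp [D, diagonal_mul, krylov_row]
  · rw [hdet, mul_assoc, krylov_mul_self (pow_card_eq_zero hA), ← mul_assoc, hDJ,
      Matrix.smul_mul, mul_assoc]

end Sets

/-! ### Rationality of Krylov data over a subfield. -/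

section Subfield

variable {K : Type*} [Field K] (L : Subfield K) {m n : ℕ}

theorem exists_map_subtype_eq {A : Matrix (Fin n) (Fin n) K} (hA : ∀ i j, A i j ∈ L) :
    ∃ A' : Matrix (Fin n) (Fin n) L, A'.map L.subtype = A :=
  ⟨of fun i j => ⟨A i j, hA i j⟩, rfl⟩

theorem krylov_mem {A : Matrix (Fin n) (Fin n) K} (hA : ∀ i j, A i j ∈ L) {u : Fin n → K}
    (hu : ∀ i, u i ∈ L) (i j : Fin n) : krylov u A i j ∈ L := by
  obtain ⟨A, rfl⟩ := exists_map_subtype_eq L hA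
  obtain ⟨u, rfl⟩ : ∃ u' : Fin n → L, L.subtype ∘ u' = u := ⟨fun i => ⟨u i, hu i⟩, rfl⟩
  rw [← krylov_map]
  exact (krylov u A i j).2

theorem det_mem {A : Matrix (Fin n) (Fin n) K} (hA : ∀ i j, A i j ∈ L) : A.det ∈ L := by
  obtain ⟨A, rfl⟩ := exists_map_subtype_eq L hA
  rw [← RingHom.mapMatrix_apply, ← RingHom.map_det]
  exact A.det.2

/-- The coefficients are the unique solution of an invertible linear system defined over `L`. -/
theorem coeff_mem {A : Matrix (Fin n) (Fin n) K} (hA : ∀ i j, A i j ∈ L) {u : Fin n → K}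
    (hu : ∀ i, u i ∈ L) (hdet : (krylov u A).det ≠ 0) {c : Fin n → K}
    (hc : ∀ i j, (∑ l, c l • A ^ (l : ℕ)) i j ∈ L) (l : Fin n) : c l ∈ L := by
  obtain ⟨B, hB⟩ := exists_map_subtype_eq L hc
  obtain ⟨A, rfl⟩ := exists_map_subtype_eq L hA
  obtain ⟨u, rfl⟩ : ∃ u' : Fin n → L, L.subtype ∘ u' = u := ⟨fun i => ⟨u i, hu i⟩, rfl⟩
  have hdet' : IsUnit (krylov u A).det := by
    rw [isUnit_iff_ne_zero]
    intro h0
    apply hdet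
    rw [← krylov_map, ← RingHom.mapMatrix_apply, ← RingHom.map_det, h0, map_zero]
  set c' := u ᵥ* B ᵥ* (krylov u A)⁻¹
  have h1 : c' ᵥ* krylov u A = u ᵥ* B := by
    rw [vecMul_vecMul, nonsing_inv_mul _ hdet', vecMul_one]
  have h2 : (L.subtype ∘ c') ᵥ* krylov (L.subtype ∘ u) (A.map L.subtype) =
      c ᵥ* krylov (L.subtype ∘ u) (A.map L.subtype) := by
    rw [vecMul_krylov c, ← hB, ← krylov_map]
    funext i
    rw [← RingHom.map_vecMul, ← RingHom.map_vecMul, h1]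
  have h3 := vecMul_injective_of_isUnit ((isUnit_iff_isUnit_det _).2 hdet.isUnit) h2
  rw [← h3]
  exact (c' l).2

end Subfield

open MvPolynomial

/-! ### Closedness of commuting varieties and openness of cyclicity. -/

section Topology

variable {k : Type*} [Field k] {n r : ℕ}

theorem range_param_subset_closure [Infinite k] {σ : Type*}
    (F : Fin r → Matrix (Fin n) (Fin n) (MvPolynomial σ k)) {h : MvPolynomial σ k} (hh : h ≠ 0) :
    Set.range (param F) ⊆ closure (param F '' {y | eval y h ≠ 0}) := by
  refine subset_closure.trans (closure_subset_closure_of_vanishingIdeal_le ?_)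
  rw [vanishingIdeal_eq_ker F hh (S := param F '' {y | eval y h ≠ 0}) (fun y hy => ⟨y, hy, rfl⟩)
      ((Set.image_subset_range _ _).trans subset_closure),
    vanishingIdeal_eq_ker F one_ne_zero (S := Set.range (param F)) (fun y _ => ⟨y, rfl⟩)
      subset_closure]

/-- The matrix of coordinate functions of the `i`-th entry of a tuple. -/
noncomputable def coordMatrix (k : Type*) [Field k] (n : ℕ) {r : ℕ} (i : Fin r) :
    Matrix (Fin n) (Fin n) (MvPolynomial (Fin r × Fin n × Fin n) k) :=
  of fun a b => X (i, a, b)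

/-- Evaluation at a tuple, as a ring homomorphism. -/
noncomputable def evalHom (x : MatTuple k n r) :
    MvPolynomial (Fin r × Fin n × Fin n) k →+* k := eval fun t => x t.1 t.2.1 t.2.2

theorem coordMatrix_map (x : MatTuple k n r) (i : Fin r) :
    (coordMatrix k n i).map (evalHom x) = x i := by
  ext a b
  simp [coordMatrix, evalHom]

theorem isClosed_matrix_eq_zero
    (P : Matrix (Fin n) (Fin n) (MvPolynomial (Fin r × Fin n × Fin n) k)) :
    IsClosed {x : MatTuple k n r | P.map (evalHom x) = 0} := by
  refine (isClosed_iff _).2 ⟨Set.range fun t : Fin n × Fin n => P t.1 t.2, ?_⟩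
  ext x
  constructor
  · rintro hx _ ⟨t, rfl⟩
    exact congrFun (congrFun hx t.1) t.2
  · intro hx
    ext a b
    exact hx _ ⟨(a, b), rfl⟩

theorem isClosed_commVariety {V : Set (Matrix (Fin n) (Fin n) k)}
    (hV : ∀ i : Fin r, IsClosed {x : MatTuple k n r | x i ∈ V}) :
    IsClosed (commVariety r V) := by
  have : commVariety r V = (⋂ i, {x : MatTuple k n r | x i ∈ V}) ∩
      ⋂ i, ⋂ j, {x : MatTuple k n r |
        (coordMatrix k n i * coordMatrix k n j - coordMatrix k n j * coordMatrix k n i).map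
          (evalHom x) = 0} := by
    ext x
    simp only [commVariety, Set.mem_ofPred_eq, Set.mem_inter_iff, Set.mem_iInter,
      ← RingHom.mapMatrix_apply, map_sub, map_mul]
    simp only [RingHom.mapMatrix_apply, coordMatrix_map, sub_eq_zero]
  rw [this]
  exact (isClosed_iInter hV).inter (isClosed_iInter fun i => isClosed_iInter fun j =>
    isClosed_matrix_eq_zero _)

theorem isClosed_commVariety_univ :
    IsClosed (commVariety r (Set.univ : Set (Matrix (Fin n) (Fin n) k))) :=
  isClosed_commVariety fun i => by simp

theorem isClosed_commVariety_nilCone : IsClosed (commVariety r (nilCone k n)) := by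
  refine isClosed_commVariety fun i => ?_
  convert! isClosed_matrix_eq_zero (r := r) (coordMatrix k n i ^ n) using 1
  ext x
  simp only [nilCone, Set.mem_ofPred_eq, ← RingHom.mapMatrix_apply, map_pow]
  rw [RingHom.mapMatrix_apply, coordMatrix_map]
  exact ⟨pow_card_eq_zero, fun h => ⟨n, h⟩⟩

theorem isOpen_isCyclic (i : Fin r) : IsOpen {x : MatTuple k n r | IsCyclic (x i)} := by
  have : {x : MatTuple k n r | IsCyclic (x i)} =
      ⋃ u : Fin n → k, (zeros {(krylov (C ∘ u) (coordMatrix k n i)).det})ᶜ := by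
    ext x
    simp only [IsCyclic, zeros, Set.mem_ofPred_eq, Set.mem_iUnion, Set.mem_compl_iff,
      Set.mem_singleton_iff, forall_eq]
    refine exists_congr fun u => not_congr ?_
    change _ ↔ evalHom x _ = 0
    rw [RingHom.map_det, RingHom.mapMatrix_apply, krylov_map, coordMatrix_map,
      show evalHom x ∘ C ∘ u = u from funext fun j => by simp [evalHom]]
  rw [this]
  exact isOpen_iUnion fun u => (isClosed_zeros _).isOpen_compl

theorem isIrreducible_iff_eq_closure {X : Type*} [TopologicalSpace X] {Z U : Set X}
    (hZ : IsClosed Z) (hU : IsOpen U) (hne : (Z ∩ U).Nonempty)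
    (hirr : IsIrreducible (closure (Z ∩ U))) : IsIrreducible Z ↔ Z = closure (Z ∩ U) := by
  constructor
  · intro h
    exact (subset_closure_inter_of_isPreirreducible_of_isOpen h.2 hU hne).antisymm
      (closure_minimal Set.inter_subset_left hZ)
  · intro h
    rw [h]
    exact hirr

end Topology

/-! ### Generic parametrizations, irreducibility and dimension. -/

section Parametrizations

variable {k : Type*} [Field k] {m s : ℕ}

theorem single_mem {K : Type*} [Field K] (L : Subfield K) (i : Fin (m + 1)) :
    (Pi.single 0 1 : Fin (m + 1) → K) i ∈ L := by
  rw [Pi.single_apply]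
  split_ifs
  exacts [L.one_mem, L.zero_mem]

theorem comp_single {R S : Type*} [CommRing R] [CommRing S] (f : R →+* S) :
    f ∘ (Pi.single 0 1 : Fin (m + 1) → R) = Pi.single 0 1 := by
  funext i
  rw [Function.comp_apply, Pi.single_apply, Pi.single_apply]
  split_ifs <;> simp

theorem param_polyTuple {σ : Type*} (A : Matrix (Fin (m + 1)) (Fin (m + 1)) (MvPolynomial σ k))
    (c : Fin s → Fin (m + 1) → MvPolynomial σ k) (y : σ → k) :
    param (polyTuple A c) y = polyTuple (A.map (eval y)) (fun i l => eval y (c i l)) :=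
  funext fun i => polyTuple_map (eval y) A c i

/-- The tuples in `C_r(𝔤𝔩_n)` whose first entry has a cyclic vector. -/
def cyclicLocus (k : Type*) [Field k] (m s : ℕ) : Set (MatTuple k (m + 1) (s + 1)) :=
  commVariety (s + 1) Set.univ ∩ {x | IsCyclic (x 0)}

/-- The tuples in `C_r(𝒩_n)` whose first entry has a cyclic vector. -/
def nilCyclicLocus (k : Type*) [Field k] (m s : ℕ) : Set (MatTuple k (m + 1) (s + 1)) :=
  commVariety (s + 1) (nilCone k (m + 1)) ∩ {x | IsCyclic (x 0)}

/-- A generic matrix, with independent entries. -/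
noncomputable def genericMatrix (k : Type*) [Field k] (m : ℕ) (β : Type*) :
    Matrix (Fin (m + 1)) (Fin (m + 1)) (MvPolynomial ((Fin (m + 1) × Fin (m + 1)) ⊕ β) k) :=
  of fun i j => X (Sum.inl (i, j))

theorem genericMatrix_map (β : Type*) (A : Matrix (Fin (m + 1)) (Fin (m + 1)) k) (c : β → k) :
    (genericMatrix k m β).map (eval (Sum.elim (fun t => A t.1 t.2) c)) = A := by
  ext i j
  simp [genericMatrix]

/-- A generic matrix with first row `(1, 0, …, 0)`. -/
noncomputable def genericRowMatrix (k : Type*) [Field k] (m : ℕ) (β : Type*) :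
    Matrix (Fin (m + 1)) (Fin (m + 1)) (MvPolynomial ((Fin m × Fin (m + 1)) ⊕ β) k) :=
  of (Fin.cons (Pi.single 0 1) fun i j => X (Sum.inl (i, j)))

theorem genericRowMatrix_map (β : Type*) (A : Matrix (Fin (m + 1)) (Fin (m + 1)) k)
    (hA : A 0 = Pi.single 0 1) (c : β → k) :
    (genericRowMatrix k m β).map (eval (Sum.elim (fun t => A t.1.succ t.2) c)) = A := by
  ext i j
  refine Fin.cases ?_ (fun i => ?_) i
  · rw [hA]
    change eval _ ((Pi.single 0 1 : Fin (m + 1) → MvPolynomial _ k) j) = _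
    rw [Pi.single_apply, Pi.single_apply]
    split_ifs <;> simp
  · simp [genericRowMatrix]

/-- The parametrization of the cyclic locus by a matrix and coefficients. -/
noncomputable def cyclicParam (k : Type*) [Field k] (m s : ℕ) :
    Fin (s + 1) → Matrix (Fin (m + 1)) (Fin (m + 1))
      (MvPolynomial ((Fin (m + 1) × Fin (m + 1)) ⊕ (Fin s × Fin (m + 1))) k) :=
  polyTuple (genericMatrix k m _) fun i l => X (Sum.inr (i, l))

/-- The parametrization of the nilpotent cyclic locus by a conjugating matrix and coefficients. -/
noncomputable def nilParam (k : Type*) [Field k] (m s : ℕ) :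
    Fin (s + 1) → Matrix (Fin (m + 1)) (Fin (m + 1))
      (MvPolynomial ((Fin (m + 1) × Fin (m + 1)) ⊕ (Fin s × Fin m)) k) :=
  polyTuple (conjJordan (genericMatrix k m _)) fun i => Fin.cons 0 fun l => X (Sum.inr (i, l))

/-- The generically finite parametrization of the nilpotent cyclic locus, by a conjugating matrix
with first row `(1, 0, …, 0)` and coefficients. -/
noncomputable def nilRowParam (k : Type*) [Field k] (m s : ℕ) :
    Fin (s + 1) → Matrix (Fin (m + 1)) (Fin (m + 1))
      (MvPolynomial ((Fin m × Fin (m + 1)) ⊕ (Fin s × Fin m)) k) :=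
  polyTuple (conjJordan (genericRowMatrix k m _)) fun i => Fin.cons 0 fun l => X (Sum.inr (i, l))

theorem eval_cons_zero {σ : Type*} (y : σ → k) (c : Fin s → Fin m → MvPolynomial σ k) :
    (fun (i : Fin s) (l : Fin (m + 1)) =>
      eval y ((Fin.cons 0 (c i) : Fin (m + 1) → MvPolynomial σ k) l)) =
    fun i => Fin.cons 0 fun l => eval y (c i l) := by
  funext i l
  refine Fin.cases ?_ (fun l => ?_) l <;> simp

theorem det_krylov_generic_ne_zero (β : Type*) :
    (krylov (Pi.single 0 1) (genericMatrix k m β)).det ≠ 0 := by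
  intro h0
  -- Specialize to the Jordan block, for which the first basis vector is cyclic.
  have h := congrArg (eval (Sum.elim (fun t => jordan k (m + 1) t.1 t.2) (fun _ : β => 0))) h0
  rw [map_zero, RingHom.map_det, RingHom.mapMatrix_apply, krylov_map, genericMatrix_map,
    comp_single] at h
  have h1 := det_krylov_of_mul_eq (g := 1) (A := jordan k (m + 1)) (d := 1) (by simp)
  rw [show (1 : Matrix (Fin (m + 1)) (Fin (m + 1)) k) 0 = Pi.single 0 1 from by
    ext j; simp [one_apply, Pi.single_apply, eq_comm], h] at h1
  simp at h1

theorem cyclicLocus_of_param (y) (hy : eval y (krylov (Pi.single 0 1)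
    (genericMatrix k m (Fin s × Fin (m + 1)))).det ≠ 0) :
    param (cyclicParam k m s) y ∈ cyclicLocus k m s := by
  rw [cyclicParam, param_polyTuple]
  refine ⟨polyTuple_mem_commVariety _ _, Pi.single 0 1, ?_⟩
  rwa [RingHom.map_det, RingHom.mapMatrix_apply, krylov_map, comp_single] at hy

theorem cyclicLocus_subset : cyclicLocus k m s ⊆ Set.range (param (cyclicParam k m s)) := by
  rintro x ⟨hx, hcyc⟩
  obtain ⟨c, hc⟩ := exists_eq_polyTuple hx hcyc
  refine ⟨Sum.elim (fun t => x 0 t.1 t.2) (fun t => c t.1 t.2), ?_⟩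
  rw [cyclicParam, param_polyTuple, genericMatrix_map]
  simp only [eval_X, Sum.elim_inr]
  exact hc.symm

theorem isIrreducible_closure_cyclicLocus [Infinite k] :
    IsIrreducible (closure (cyclicLocus k m s)) :=
  isIrreducible_closure_of_param (cyclicParam k m s) (det_krylov_generic_ne_zero _)
    cyclicLocus_of_param (cyclicLocus_subset.trans subset_closure)

theorem topologicalKrullDim_closure_cyclicLocus [IsAlgClosed k] :
    topologicalKrullDim (closure (cyclicLocus k m s)) =
      ((m + 1) * (m + 1) + s * (m + 1) : ℕ) := by
  rw [topologicalKrullDim_closure_of_param (cyclicParam k m s) (det_krylov_generic_ne_zero _)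
    cyclicLocus_of_param (cyclicLocus_subset.trans subset_closure)]
  · simp
  · intro L _ hF t
    set φ := algebraMap (MvPolynomial ((Fin (m + 1) × Fin (m + 1)) ⊕ (Fin s × Fin (m + 1))) k)
      (FractionRing (MvPolynomial ((Fin (m + 1) × Fin (m + 1)) ⊕ (Fin s × Fin (m + 1))) k))
    have hφ : Function.Injective φ := IsFractionRing.injective _ _
    rcases t with ⟨a, b⟩ | ⟨i, l⟩
    · exact hF 0 a b
    · have hdet : (krylov (Pi.single 0 1) ((genericMatrix k m _).map φ)).det ≠ 0 := by
        rw [← comp_single φ, ← krylov_map, ← RingHom.mapMatrix_apply, ← RingHom.map_det]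
        exact (map_ne_zero_iff φ hφ).2 (det_krylov_generic_ne_zero _)
      refine coeff_mem L (A := (genericMatrix k m _).map φ) (fun a b => hF 0 a b) (single_mem L)
        hdet (c := fun l => φ (X (Sum.inr (i, l)))) (fun a b => ?_) l
      rw [← sum_smul_pow_map φ]
      exact hF i.succ a b

theorem conjJordan_polyTuple_mem {g : Matrix (Fin (m + 1)) (Fin (m + 1)) k} (hg : g.det ≠ 0)
    (c : Fin s → Fin m → k) :
    polyTuple (conjJordan g) (fun i => Fin.cons 0 (c i)) ∈ nilCyclicLocus k m s :=
  ⟨polyTuple_mem_commVariety_nilCone (isNilpotent_of_mul_eq hg (mul_conjJordan g)) fun _ => rfl,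
    isCyclic_of_mul_eq hg hg (mul_conjJordan g)⟩

theorem det_genericMatrix_mul_ne_zero (β : Type*) :
    (genericMatrix k m β).det *
      (krylov (Pi.single 0 1) (conjJordan (genericMatrix k m β))).det ≠ 0 := by
  intro h0
  have h := congrArg (eval (Sum.elim
    (fun t => (1 : Matrix (Fin (m + 1)) (Fin (m + 1)) k) t.1 t.2) (fun _ : β => 0))) h0
  rw [map_zero, map_mul, RingHom.map_det, RingHom.map_det, RingHom.mapMatrix_apply,
    RingHom.mapMatrix_apply, krylov_map, conjJordan_map, genericMatrix_map, comp_single] at h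
  have h1 := det_krylov_of_mul_eq (mul_conjJordan (1 : Matrix (Fin (m + 1)) (Fin (m + 1)) k))
  rw [show (1 : Matrix (Fin (m + 1)) (Fin (m + 1)) k) 0 = Pi.single 0 1 from by
    ext j; simp [one_apply, Pi.single_apply, eq_comm]] at h1
  rw [h1] at h
  simp at h

theorem nilCyclicLocus_subset [IsAlgClosed k] :
    nilCyclicLocus k m s ⊆ Set.range (param (nilParam k m s)) := by
  rintro x ⟨hx, hcyc⟩
  obtain ⟨c, hc⟩ := exists_eq_polyTuple_of_nilCone hx hcyc
  obtain ⟨g, hg⟩ := exists_conjJordan_eq (hx.1 0) hcyc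
  refine ⟨Sum.elim (fun t => g t.1 t.2) (fun t => c t.1 t.2), ?_⟩
  rw [nilParam, param_polyTuple, conjJordan_map, genericMatrix_map, hg, eval_cons_zero]
  simp only [eval_X, Sum.elim_inr]
  exact hc.symm

theorem det_genericRowMatrix_ne_zero (β : Type*) : (genericRowMatrix k m β).det ≠ 0 := by
  intro h0
  have h := congrArg (eval (Sum.elim
    (fun t => (1 : Matrix (Fin (m + 1)) (Fin (m + 1)) k) t.1.succ t.2) (fun _ : β => 0))) h0
  rw [map_zero, RingHom.map_det, RingHom.mapMatrix_apply, genericRowMatrix_map] at h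
  · simp at h
  · ext j; simp [one_apply, Pi.single_apply, eq_comm]

theorem nilCyclicLocus_of_rowParam (y)
    (hy : eval y (genericRowMatrix k m (Fin s × Fin m)).det ≠ 0) :
    param (nilRowParam k m s) y ∈ nilCyclicLocus k m s := by
  rw [nilRowParam, param_polyTuple, conjJordan_map, eval_cons_zero]
  rw [RingHom.map_det, RingHom.mapMatrix_apply] at hy
  exact conjJordan_polyTuple_mem hy _

/-- The first basis vector need not be cyclic for every matrix in the locus, but it is for generic
`g`. There `g` can be replaced by a matrix with normalized first row, and density covers the rest.
-/
theorem nilCyclicLocus_subset_closure [IsAlgClosed k] :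
    nilCyclicLocus k m s ⊆ closure (Set.range (param (nilRowParam k m s))) := by
  refine nilCyclicLocus_subset.trans ((range_param_subset_closure _
    (det_genericMatrix_mul_ne_zero _)).trans (closure_mono ?_))
  rintro _ ⟨y, hy, rfl⟩
  rw [Set.mem_ofPred_eq, map_mul, RingHom.map_det, RingHom.map_det, RingHom.mapMatrix_apply,
    RingHom.mapMatrix_apply, krylov_map, conjJordan_map, comp_single] at hy
  obtain ⟨hy1, hy2⟩ := mul_ne_zero_iff.1 hy
  obtain ⟨g, hg0, hg⟩ := exists_conjJordan_eq_of_krylov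
    (isNilpotent_of_mul_eq hy1 (mul_conjJordan _)) hy2
  refine ⟨Sum.elim (fun t => g t.1.succ t.2) (fun t => y (Sum.inr t)), ?_⟩
  rw [nilRowParam, nilParam, param_polyTuple, param_polyTuple, conjJordan_map, conjJordan_map,
    genericRowMatrix_map _ _ hg0, hg, eval_cons_zero, eval_cons_zero]
  simp only [eval_X, Sum.elim_inr]
  rfl

theorem isIrreducible_closure_nilCyclicLocus [IsAlgClosed k] :
    IsIrreducible (closure (nilCyclicLocus k m s)) :=
  isIrreducible_closure_of_param (nilRowParam k m s) (det_genericRowMatrix_ne_zero _)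
    nilCyclicLocus_of_rowParam nilCyclicLocus_subset_closure

theorem topologicalKrullDim_closure_nilCyclicLocus [IsAlgClosed k] :
    topologicalKrullDim (closure (nilCyclicLocus k m s)) = (m * (m + 1) + s * m : ℕ) := by
  rw [topologicalKrullDim_closure_of_param (nilRowParam k m s) (det_genericRowMatrix_ne_zero _)
    nilCyclicLocus_of_rowParam nilCyclicLocus_subset_closure]
  · simp
  · intro L hL hF t
    set φ := algebraMap (MvPolynomial ((Fin m × Fin (m + 1)) ⊕ (Fin s × Fin m)) k)
      (FractionRing (MvPolynomial ((Fin m × Fin (m + 1)) ⊕ (Fin s × Fin m)) k))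
    have hφ : Function.Injective φ := IsFractionRing.injective _ _
    set g := (genericRowMatrix k m (Fin s × Fin m)).map φ with hg
    have hg0 : g 0 = Pi.single 0 1 := comp_single φ
    have hd0 : g.det ≠ 0 := by
      rw [hg, ← RingHom.mapMatrix_apply, ← RingHom.map_det]
      exact (map_ne_zero_iff φ hφ).2 (det_genericRowMatrix_ne_zero _)
    have hA (a b) : conjJordan g a b ∈ L := by
      rw [hg, ← conjJordan_map]
      exact hF 0 a b
    have hK := krylov_of_mul_eq (mul_conjJordan g)
    have hdetK := det_krylov_of_mul_eq (mul_conjJordan g)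
    rw [← pow_succ] at hdetK
    have hKL := krylov_mem L hA (u := g 0) (by rw [hg0]; exact single_mem L)
    -- The Krylov determinant, which lies in `L`, is a positive power of `det g`; this is the one
    -- root extraction.
    have hdL : g.det ∈ L := hL _ _ (Nat.succ_ne_zero _) (hdetK ▸ det_mem L hKL)
    rcases t with ⟨a, b⟩ | ⟨i, l⟩
    · have h1 := hKL a.succ b
      rw [hK, diagonal_mul] at h1
      have h2 := L.mul_mem (L.inv_mem (L.pow_mem hdL a.succ)) h1
      rwa [inv_mul_cancel_left₀ (pow_ne_zero _ hd0)] at h2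
    · have hne : (krylov (g 0) (conjJordan g)).det ≠ 0 := hdetK ▸ pow_ne_zero _ hd0
      -- The constant coefficient is fixed at 0, so the parameter `l` sits at index `l.succ`.
      have := coeff_mem L hA (by rw [hg0]; exact single_mem L) hne
        (c := fun l => φ ((Fin.cons 0 fun l => X (Sum.inr (i, l)) : Fin (m + 1) → _) l))
        (fun a b => ?_) l.succ
      · simpa using this
      · rw [hg, ← conjJordan_map, ← sum_smul_pow_map φ]
        exact hF i.succ a b

theorem polyTuple_jordan_mem : polyTuple (jordan k (m + 1)) (fun _ : Fin s => 0) ∈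
    nilCyclicLocus k m s :=
  ⟨polyTuple_mem_commVariety_nilCone ⟨_, jordan_pow_card⟩ fun _ => rfl, isCyclic_jordan⟩

theorem regularClosure_eq : regularClosure k (m + 1) (s + 1) = closure (nilCyclicLocus k m s) := by
  refine congrArg closure (Set.ext fun x => ?_)
  simp only [nilCyclicLocus, Set.mem_ofPred_eq, Set.mem_inter_iff]
  refine and_congr_right fun hx => ?_
  rw [exists_prop_of_true s.succ_pos, isRegularNilpotent_iff]
  exact and_iff_right (hx.1 _)

theorem nonderogatoryClosure_eq [IsAlgClosed k] :
    nonderogatoryClosure k (m + 1) (s + 1) = closure (cyclicLocus k m s) := by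
  refine congrArg closure (Set.ext fun x => ?_)
  simp only [cyclicLocus, Set.mem_ofPred_eq, Set.mem_inter_iff]
  refine and_congr_right fun hx => ?_
  rw [exists_prop_of_true s.succ_pos, isNonderogatory_iff]
  rfl

end Parametrizations

end CommutingVariety

theorem mainTheorem10 (k : Type*) [Field k] [IsAlgClosed k] (n r : ℕ) (hn : 2 ≤ n) (hr : 2 ≤ r) :
    (IsIrreducible (CommutingVariety.commVariety r (CommutingVariety.nilCone k n)) ↔
      CommutingVariety.commVariety r (CommutingVariety.nilCone k n) =
        CommutingVariety.regularClosure k n r) ∧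
    (IsIrreducible
        (CommutingVariety.commVariety r (Set.univ : Set (Matrix (Fin n) (Fin n) k))) ↔
      CommutingVariety.commVariety r (Set.univ : Set (Matrix (Fin n) (Fin n) k)) =
        CommutingVariety.nonderogatoryClosure k n r) ∧
    IsIrreducible (CommutingVariety.regularClosure k n r) ∧
    IsIrreducible (CommutingVariety.nonderogatoryClosure k n r) ∧
    topologicalKrullDim (CommutingVariety.regularClosure k n r) =
      ((n ^ 2 - n + (r - 1) * (n - 1) : ℕ) : WithBot ℕ∞) ∧
    topologicalKrullDim (CommutingVariety.nonderogatoryClosure k n r) =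
      ((n ^ 2 + (r - 1) * n : ℕ) : WithBot ℕ∞) := by
  obtain ⟨m, rfl⟩ : ∃ m, n = m + 1 := ⟨n - 1, by omega⟩
  obtain ⟨s, rfl⟩ : ∃ s, r = s + 1 := ⟨r - 1, by omega⟩
  rw [CommutingVariety.regularClosure_eq, CommutingVariety.nonderogatoryClosure_eq]
  -- The tuple `(J, 0, …, 0)` witnesses that both cyclic loci are nonempty.
  have hmem := CommutingVariety.polyTuple_jordan_mem (k := k) (m := m) (s := s)
  refine ⟨?_, ?_, CommutingVariety.isIrreducible_closure_nilCyclicLocus,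
    CommutingVariety.isIrreducible_closure_cyclicLocus, ?_, ?_⟩
  · exact CommutingVariety.isIrreducible_iff_eq_closure
      CommutingVariety.isClosed_commVariety_nilCone (CommutingVariety.isOpen_isCyclic 0)
      ⟨_, hmem⟩ CommutingVariety.isIrreducible_closure_nilCyclicLocus
  · exact CommutingVariety.isIrreducible_iff_eq_closure
      CommutingVariety.isClosed_commVariety_univ (CommutingVariety.isOpen_isCyclic 0)
      ⟨_, ⟨fun _ => trivial, hmem.1.2⟩, hmem.2⟩ CommutingVariety.isIrreducible_closure_cyclicLocus
  · rw [CommutingVariety.topologicalKrullDim_closure_nilCyclicLocus]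
    congr 1
    -- This form lets the truncated subtraction `n ^ 2 - n` cancel.
    have : (m + 1) ^ 2 = m * (m + 1) + (m + 1) := by ring
    rw [this]
    simp
  · rw [CommutingVariety.topologicalKrullDim_closure_cyclicLocus]
    congr 1
    rw [sq]
    simp
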